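/- For real $\nu>-1$ and $x>0$ let $J_\nu(x)=\sum_{n\ge 0}\frac{(-1)^n}{n!\,\Gamma(n+\nu+1)}\left(\frac{x}{2}\right)^{2n+\nu}$ be the Bessel function of the first kind, and let $d_\nu(x)=(1-\nu)J_\nu(x)+xJ_\nu'(x)$ be the Dini function. For every $\nu>-1$ the function $d_\nu$ has a smallest positive zero $\alpha_{\nu,1}$, and the following hold, where "increasing" means non-decreasing. (i) For every $x\in(0,\alpha_{\nu,1})$ we have $d_\mu(x)>0$ for all $\mu\ge\nu$, and the functions $$\mu\mapsto 2^{\mu}\Gamma(\mu+1)x^{-\mu}d_\mu(x)\qquad\text{and}\qquad \mu\mapsto\frac{x\,d_\mu'(x)}{d_\mu(x)}$$ are increasing on $[\nu,\infty)$. (ii) For all $\mu\ge\nu$ and $x\in(0,\alpha_{\nu,1})$, $$x^{\nu-\mu}\frac{d_\mu(x)}{d_\nu(x)}\ge 2^{\nu-\mu}\frac{\Gamma(\nu+1)}{\Gamma(\mu+1)}\qquad\text{and}\qquad \frac{d_\mu'(x)}{d_\mu(x)}\ge\frac{d_\nu'(x)}{d_\nu(x)}.$$ (iii) For all $\mu\ge\nu$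 the function $x\mapsto d_\mu(x)/d_\nu(x)$ is increasing on $(0,\alpha_{\nu,1})$. -/

import Mathlib

noncomputable section

/-- The Bessel function of the first kind of real order `ν`, on the positive half-line:
`J_ν(x) = ∑ (-1)^n / (n! Γ(n + ν + 1)) (x/2)^(2n + ν)`.
The value `Real.Gamma = 0` at the poles of `Γ` gives the usual convention `1/Γ = 0` there. -/
def besselJ (ν x : ℝ) : ℝ :=
  ∑' n : ℕ, (-1 : ℝ) ^ n / ((n.factorial : ℝ) * Real.Gamma ((n : ℝ) + ν + 1)) *
    (x / 2) ^ (2 * (n : ℝ) + ν)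

/-- The Dini function `d_ν(x) = (1 - ν) J_ν(x) + x J_ν'(x)`. -/
def dini (ν x : ℝ) : ℝ :=
  (1 - ν) * besselJ ν x + x * deriv (besselJ ν) x

/-- The first positive zero `α_{ν,1}` of the Dini function `d_ν`. -/
def diniZero (ν : ℝ) : ℝ :=
  sInf {x : ℝ | 0 < x ∧ dini ν x = 0}

end

/-!
In the variable `t = x ^ 2 / 4`, and up to the factor `(x / 2) ^ ν / Γ(ν + 1)`, the Dini function
`d_ν` is an entire function `N_ν` with `N_ν(0) = 1`. For `ν < μ` the quotients of the Taylor
coefficients of `N_μ` and `N_ν` are the moments of `Beta(ν + 1, μ - ν)`, so `N_μ(t)` is the average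
of `N_ν(t * u)` over this distribution of `u`. Hence it suffices that, up to its first zero, `N_ν`
is decreasing and `log N_ν(exp s)` is concave in `s`: the first gives `N_ν ≤ N_μ`, and the second
makes `N_μ(t) / N_ν(t)` an average of the increasing functions `t ↦ N_ν(t * u) / N_ν(t)`.

With `w = C_{ν+1} / C_ν` the quotient of consecutive Bessel–Clifford functions and `Q = (t * w)'`,
one has `t * N_ν' / N_ν = -t * w - 2 * t * Q / (1 - 2 * t * w)`. The Riccati equation of `w` yields
linear first-order equations for `Q` and for `(t * Q)'`, both with integrating factor
`t ^ (ν + 1) * C_ν ^ 2` and with the positive right-hand sides `1` and `1 + 2 * t * Q ^ 2`. So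
`t * w` and `t * Q` are increasing, which gives both properties of `N_ν`.
-/

open MeasureTheory ProbabilityTheory Set Filter Topology

section RealAnalysis

lemma pos_of_mul_add_mul_deriv_pos {φ φ' : ℝ → ℝ} {a T : ℝ} (ha : 0 < a)
    (hc : ContinuousOn φ (Ico 0 T)) (hd : ∀ t ∈ Ioo 0 T, HasDerivAt φ (φ' t) t)
    (hpos : ∀ t ∈ Ioo 0 T, 0 < a * φ t + t * φ' t) {t : ℝ} (ht : t ∈ Ioo 0 T) : 0 < φ t := by
  have hderiv : ∀ s ∈ Ioo 0 T,
      HasDerivAt (fun s ↦ s ^ a * φ s) (s ^ (a - 1) * (a * φ s + s * φ' s)) s := by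
    intro s hs
    refine ((Real.hasDerivAt_rpow_const (Or.inl hs.1.ne')).mul (hd s hs)).congr_deriv ?_
    rw [Real.rpow_sub_one hs.1.ne']
    field_simp [hs.1.ne']
  have hmono : StrictMonoOn (fun s ↦ s ^ a * φ s) (Ico 0 T) := by
    refine strictMonoOn_of_hasDerivWithinAt_pos (convex_Ico 0 T)
      ((Real.continuous_rpow_const ha.le).continuousOn.mul hc)
      (f' := fun s ↦ s ^ (a - 1) * (a * φ s + s * φ' s)) ?_ ?_ <;>
      rw [interior_Ico] <;> intro s hs
    · exact (hderiv s hs).hasDerivWithinAt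
    · exact mul_pos (Real.rpow_pos_of_pos hs.1 _) (hpos s hs)
  have hlt : 0 ^ a * φ 0 < t ^ a * φ t :=
    hmono (left_mem_Ico.2 (ht.1.trans ht.2)) (Ioo_subset_Ico_self ht) ht.1
  rw [Real.zero_rpow ha.ne', zero_mul] at hlt
  exact pos_of_mul_pos_right hlt (Real.rpow_nonneg ht.1.le a)

lemma monotoneOn_div_iff_logDeriv_le {f g : ℝ → ℝ} {s : Set ℝ} (hs : IsOpen s)
    (hs' : Convex ℝ s) (hf : ∀ x ∈ s, DifferentiableAt ℝ f x)
    (hg : ∀ x ∈ s, DifferentiableAt ℝ g x) (hf0 : ∀ x ∈ s, 0 < f x) (hg0 : ∀ x ∈ s, 0 < g x) :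
    MonotoneOn (fun x ↦ f x / g x) s ↔ ∀ x ∈ s, logDeriv g x ≤ logDeriv f x := by
  have hdiff : ∀ x ∈ s, DifferentiableAt ℝ (fun x ↦ f x / g x) x :=
    fun x hx ↦ (hf x hx).div (hg x hx) (hg0 x hx).ne'
  have hderiv : ∀ x ∈ s, 0 ≤ deriv (fun x ↦ f x / g x) x ↔ logDeriv g x ≤ logDeriv f x := by
    intro x hx
    rw [← sub_nonneg (b := logDeriv g x),
      ← logDeriv_div x (hf0 x hx).ne' (hg0 x hx).ne' (hf x hx) (hg x hx), logDeriv_apply,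
      le_div_iff₀ (div_pos (hf0 x hx) (hg0 x hx)), zero_mul]
  refine ⟨fun h x hx ↦ (hderiv x hx).1 ?_, fun h ↦ ?_⟩
  · rw [← derivWithin_of_isOpen hs hx]
    exact h.derivWithin_nonneg
  · refine monotoneOn_of_deriv_nonneg hs'
      (fun x hx ↦ (hdiff x hx).continuousAt.continuousWithinAt) ?_ ?_ <;>
      rw [hs.interior_eq] <;> intro x hx
    · exact (hdiff x hx).differentiableWithinAt
    · exact (hderiv x hx).2 (h x hx)

lemma mul_mem_Ioo_of_mem_Ioo_zero_one {T t u : ℝ} (ht : t ∈ Ioo 0 T) (hu : u ∈ Ioo (0 : ℝ) 1) :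
    t * u ∈ Ioo 0 T :=
  ⟨mul_pos ht.1 hu.1, (mul_le_of_le_one_right ht.1.le hu.2.le).trans_lt ht.2⟩

-- The hypothesis says that `s ↦ log (g (exp s))` is concave.
lemma monotoneOn_comp_mul_div {g : ℝ → ℝ} {T u : ℝ}
    (hg : ∀ t ∈ Ioo 0 T, DifferentiableAt ℝ g t) (hg0 : ∀ t ∈ Ioo 0 T, 0 < g t)
    (hlog : AntitoneOn (fun t ↦ t * logDeriv g t) (Ioo 0 T)) (hu : u ∈ Ioo (0 : ℝ) 1) :
    MonotoneOn (fun t ↦ g (t * u) / g t) (Ioo 0 T) := by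
  have hmem {t : ℝ} (ht : t ∈ Ioo 0 T) := mul_mem_Ioo_of_mem_Ioo_zero_one ht hu
  have hscale (t : ℝ) : DifferentiableAt ℝ (fun t : ℝ ↦ t * u) t := by fun_prop
  refine (monotoneOn_div_iff_logDeriv_le isOpen_Ioo (convex_Ioo 0 T)
    (f := fun t ↦ g (t * u)) (fun t ht ↦ (hg _ (hmem ht)).fun_comp' t (hscale t)) hg
    (fun t ht ↦ hg0 _ (hmem ht)) hg0).2 fun t ht ↦ ?_
  have hcomp : logDeriv (fun t ↦ g (t * u)) t = logDeriv g (t * u) * u := by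
    have h := logDeriv_comp (g := fun t ↦ t * u) (hg _ (hmem ht)) (hscale t)
    rwa [deriv_mul_const_field, deriv_id'', one_mul] at h
  have hle : t * logDeriv g t ≤ t * u * logDeriv g (t * u) :=
    hlog (hmem ht) ht (mul_le_of_le_one_right ht.1.le hu.2.le)
  rw [hcomp]
  exact le_of_mul_le_mul_left (hle.trans_eq (by ring)) ht.1

lemma isLeast_sInf_pos_zeros {g : ℝ → ℝ} (hg : Continuous g) (h0 : 0 < g 0)
    (hne : ∃ x, 0 < x ∧ g x = 0) :
    IsLeast {x | 0 < x ∧ g x = 0} (sInf {x | 0 < x ∧ g x = 0}) := by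
  have hbdd : BddBelow {x | 0 < x ∧ g x = 0} := ⟨0, fun x hx ↦ hx.1.le⟩
  have heq : {x | 0 < x ∧ g x = 0} = Ici 0 ∩ {x | g x = 0} := by
    ext x
    refine and_congr_left fun (hx : g x = 0) ↦ ⟨le_of_lt, fun h ↦ lt_of_le_of_ne h ?_⟩
    rintro rfl
    exact h0.ne' hx
  have hclosed : IsClosed {x | 0 < x ∧ g x = 0} :=
    heq ▸ isClosed_Ici.inter (isClosed_eq hg continuous_const)
  exact ⟨hclosed.csInf_mem hne hbdd, fun x hx ↦ csInf_le hbdd hx⟩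

lemma pos_of_forall_ne_zero {g : ℝ → ℝ} {x : ℝ} (hg : Continuous g) (h0 : 0 < g 0)
    (hx : 0 ≤ x) (hne : ∀ y ∈ Ioc 0 x, g y ≠ 0) : 0 < g x := by
  by_contra! hle
  obtain ⟨y, hy, hgy⟩ := intermediate_value_Icc' hx hg.continuousOn ⟨hle, h0.le⟩
  rcases hy.1.eq_or_lt with rfl | hy0
  · exact h0.ne' hgy
  · exact hne y ⟨hy0, hy.2⟩ hgy

end RealAnalysis

section PowerSeries

variable {𝕜 : Type*} [RCLike 𝕜]

lemma hasDerivAt_tsum_mul_pow {a : ℕ → 𝕜}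
    (ha : ∀ z, Summable fun n : ℕ ↦ ((n : 𝕜) + 1) * a (n + 1) * z ^ n) (z : 𝕜) :
    HasDerivAt (fun z ↦ ∑' n, a n * z ^ n) (∑' n : ℕ, ((n : 𝕜) + 1) * a (n + 1) * z ^ n) z := by
  set R : ℝ := ‖z‖ + 1
  have hbound : Summable fun n : ℕ ↦ ‖a n * (n * (R : 𝕜) ^ (n - 1))‖ := by
    refine (summable_nat_add_iff 1).1 ((ha R).norm.congr fun n ↦ ?_)
    push_cast
    ring_nf
  have hderiv := hasDerivAt_tsum_of_isPreconnected (y₀ := 0) (y := z) hbound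
    Metric.isOpen_ball (convex_ball (0 : 𝕜) R).isPreconnected
    (fun n y _ ↦ (hasDerivAt_pow n y).const_mul (a n)) (fun n y hy ↦ ?_)
    (Metric.mem_ball_self (by positivity))
    (summable_of_ne_finset_zero (s := {0}) fun n hn ↦ by simp_all)
    (by simp [R])
  · refine hderiv.congr_deriv ?_
    have hsum : Summable fun n : ℕ ↦ a n * (n * z ^ (n - 1)) :=
      (summable_nat_add_iff 1).1 ((ha z).congr fun n ↦ by push_cast; ring)
    rw [hsum.tsum_eq_zero_add]
    simp only [CharP.cast_eq_zero, zero_mul, mul_zero, zero_add]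
    exact tsum_congr fun n ↦ by push_cast; ring
  · have hy' : ‖y‖ ≤ ‖(R : 𝕜)‖ := by
      rw [RCLike.norm_ofReal, abs_of_nonneg (by positivity)]
      exact (mem_ball_zero_iff.1 hy).le
    simp only [norm_mul, norm_pow]
    gcongr

end PowerSeries

section Dilations

variable {m : Measure ℝ} [IsFiniteMeasure m]

lemma integrable_comp_mul (hm : ∀ᵐ u ∂m, |u| ≤ 1) {φ : ℝ → ℝ} (hφ : Continuous φ) (t : ℝ) :
    Integrable (fun u ↦ φ (t * u)) m := by
  have hc : Continuous fun u ↦ φ (t * u) := by fun_prop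
  obtain ⟨B, hB⟩ := isCompact_Icc.exists_bound_of_continuousOn (s := Icc (-1) 1) hc.continuousOn
  refine Integrable.of_bound hc.aestronglyMeasurable B ?_
  filter_upwards [hm] with u hu using hB u (abs_le.1 hu)

lemma hasSum_integral_comp_mul (hm : ∀ᵐ u ∂m, |u| ≤ 1) {a : ℕ → ℝ} {g : ℝ → ℝ}
    (hg : ∀ t, HasSum (fun n ↦ a n * t ^ n) (g t)) (t : ℝ) :
    HasSum (fun n ↦ a n * (∫ u, u ^ n ∂m) * t ^ n) (∫ u, g (t * u) ∂m) := by
  have hint (n : ℕ) : Integrable (fun u ↦ a n * (t * u) ^ n) m :=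
    integrable_comp_mul hm (φ := fun t ↦ a n * t ^ n) (by fun_prop) t
  have hbound (n : ℕ) : ∫ u, ‖a n * (t * u) ^ n‖ ∂m ≤ m.real univ * ‖a n * t ^ n‖ := by
    rw [← smul_eq_mul, ← integral_const]
    refine integral_mono_ae (hint n).norm (integrable_const _) ?_
    filter_upwards [hm] with u hu
    rw [mul_pow, ← mul_assoc, norm_mul _ (u ^ n), norm_pow u]
    exact mul_le_of_le_one_right (norm_nonneg _) (pow_le_one₀ (abs_nonneg u) hu)
  have hsum : Summable fun n ↦ ∫ u, ‖a n * (t * u) ^ n‖ ∂m :=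
    .of_nonneg_of_le (fun n ↦ integral_nonneg fun u ↦ norm_nonneg _) hbound
      ((hg t).summable.norm.mul_left _)
  have h := hasSum_integral_of_summable_integral_norm hint hsum
  simp_rw [(hg _).tsum_eq] at h
  refine h.congr_fun fun n ↦ ?_
  simp_rw [mul_pow, integral_const_mul]
  ring

end Dilations

section Beta

variable {α β : ℝ}

lemma measurable_betaPDF (α β : ℝ) : Measurable (betaPDF α β) :=
  (measurable_betaPDFReal α β).ennreal_ofReal

lemma ae_betaMeasure_mem_Ioo (α β : ℝ) : ∀ᵐ u ∂betaMeasure α β, u ∈ Ioo (0 : ℝ) 1 := by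
  rw [betaMeasure, ae_withDensity_iff (measurable_betaPDF α β)]
  refine ae_of_all _ fun u hu ↦ ?_
  by_contra h
  exact hu (by rw [betaPDF_eq, if_neg (mem_Ioo.not.1 h), ENNReal.ofReal_zero])

lemma ae_betaMeasure_abs_le_one (α β : ℝ) : ∀ᵐ u ∂betaMeasure α β, |u| ≤ 1 := by
  filter_upwards [ae_betaMeasure_mem_Ioo α β] with u hu
  rw [abs_of_pos hu.1]
  exact hu.2.le

lemma integral_betaMeasure (hα : 0 < α) (hβ : 0 < β) (f : ℝ → ℝ) :
    ∫ u, f u ∂betaMeasure α β = ∫ u, betaPDFReal α β u * f u := by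
  rw [betaMeasure, integral_withDensity_eq_integral_toReal_smul
    (measurable_betaPDF α β) (ae_of_all _ fun _ ↦ ENNReal.ofReal_lt_top)]
  refine integral_congr_ae (ae_of_all _ fun u ↦ ?_)
  have hnonneg : 0 ≤ betaPDFReal α β u := by
    by_cases hu : 0 < u ∧ u < 1
    · exact (betaPDFReal_pos hu.1 hu.2 hα hβ).le
    · rw [betaPDFReal, if_neg hu]
  simp only [betaPDF, ENNReal.toReal_ofReal hnonneg, smul_eq_mul]

lemma betaPDFReal_mul_rpow {s : ℝ} (hα : 0 < α) (hβ : 0 < β) (hs : 0 < α + s) (u : ℝ) :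
    betaPDFReal α β u * u ^ s = beta (α + s) β / beta α β * betaPDFReal (α + s) β u := by
  by_cases hu : 0 < u ∧ u < 1
  · have hne := (beta_pos hα hβ).ne'
    have hne' := (beta_pos hs hβ).ne'
    rw [betaPDFReal, betaPDFReal, if_pos hu, if_pos hu, show α + s - 1 = α - 1 + s by ring,
      Real.rpow_add hu.1]
    field_simp
  · rw [betaPDFReal, betaPDFReal, if_neg hu, if_neg hu, zero_mul, mul_zero]

lemma integral_rpow_betaMeasure {s : ℝ} (hα : 0 < α) (hβ : 0 < β) (hs : 0 < α + s) :
    ∫ u, u ^ s ∂betaMeasure α β = beta (α + s) β / beta α β := by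
  have := isProbabilityMeasureBeta hs hβ
  have hone : ∫ u, betaPDFReal (α + s) β u = 1 := by
    simpa using (integral_betaMeasure hs hβ fun _ ↦ 1).symm
  simp_rw [integral_betaMeasure hα hβ, betaPDFReal_mul_rpow hα hβ hs, integral_const_mul, hone,
    mul_one]

end Beta

section BesselClifford

/-- The power series coefficients of the Bessel–Clifford function `besselClifford ν`. -/
noncomputable def besselCliffordCoeff (ν : ℝ) (n : ℕ) : ℝ :=
  (-1) ^ n / (n.factorial * Real.Gamma (n + ν + 1))

/-- The Bessel–Clifford function `C_ν`, the entire function with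
`J_ν(x) = (x / 2) ^ ν * C_ν(x ^ 2 / 4)` for `x > 0`. -/
noncomputable def besselClifford (ν t : ℝ) : ℝ :=
  ∑' n, besselCliffordCoeff ν n * t ^ n

variable {ν : ℝ}

lemma succ_mul_besselCliffordCoeff_succ (ν : ℝ) (n : ℕ) :
    (n + 1) * besselCliffordCoeff ν (n + 1) = -besselCliffordCoeff (ν + 1) n := by
  rw [besselCliffordCoeff, besselCliffordCoeff, Nat.factorial_succ, pow_succ, Nat.cast_mul,
    Nat.cast_succ, show (n : ℝ) + 1 + ν + 1 = n + (ν + 1) + 1 by ring]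
  field_simp

lemma besselCliffordCoeff_eq_mul (ν : ℝ) (n : ℕ) :
    besselCliffordCoeff ν n = (n + ν + 1) * besselCliffordCoeff (ν + 1) n := by
  simp only [besselCliffordCoeff]
  rcases eq_or_ne ((n : ℝ) + ν + 1) 0 with h | h
  · rw [h, Real.Gamma_zero, mul_zero, div_zero, zero_mul]
  · rw [show (n : ℝ) + (ν + 1) + 1 = n + ν + 1 + 1 by ring, Real.Gamma_add_one h]
    field_simp

lemma summable_besselCliffordCoeff (ν t : ℝ) :
    Summable fun n ↦ besselCliffordCoeff ν n * t ^ n := by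
  refine summable_of_ratio_norm_eventually_le (r := 1 / 2) (by norm_num) ?_
  filter_upwards [eventually_ge_atTop ⌈max |ν| (2 * |t|)⌉₊] with n hn
  have hn' : max |ν| (2 * |t|) ≤ n := Nat.ceil_le.1 hn
  have hν : 1 ≤ n + ν + 1 := by linarith [neg_abs_le ν, (le_max_left _ _).trans hn']
  have ht : 2 * |t| ≤ n + 1 := by linarith [(le_max_right _ _).trans hn']
  have hrec : (n + 1) * (n + ν + 1) * besselCliffordCoeff ν (n + 1) = -besselCliffordCoeff ν n := by
    rw [besselCliffordCoeff_eq_mul ν n, mul_right_comm, succ_mul_besselCliffordCoeff_succ]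
    ring
  have hle : (n + 1) * |besselCliffordCoeff ν (n + 1)| ≤ |besselCliffordCoeff ν n| := by
    have hfactor : (n : ℝ) + 1 ≤ (n + 1) * (n + ν + 1) := le_mul_of_one_le_right (by positivity) hν
    rw [← abs_neg (besselCliffordCoeff ν n), ← hrec, abs_mul]
    gcongr
    exact hfactor.trans (le_abs_self _)
  rw [pow_succ, Real.norm_eq_abs, Real.norm_eq_abs, abs_mul, abs_mul, abs_mul]
  calc |besselCliffordCoeff ν (n + 1)| * (|t ^ n| * |t|)
      = 1 / 2 * (2 * |t| * |besselCliffordCoeff ν (n + 1)| * |t ^ n|) := by ring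
    _ ≤ 1 / 2 * ((n + 1) * |besselCliffordCoeff ν (n + 1)| * |t ^ n|) := by gcongr
    _ ≤ 1 / 2 * (|besselCliffordCoeff ν n| * |t ^ n|) := by gcongr

lemma hasSum_besselClifford (ν t : ℝ) :
    HasSum (fun n ↦ besselCliffordCoeff ν n * t ^ n) (besselClifford ν t) :=
  (summable_besselCliffordCoeff ν t).hasSum

lemma hasDerivAt_besselClifford (ν t : ℝ) :
    HasDerivAt (besselClifford ν) (-besselClifford (ν + 1) t) t := by
  have hderiv (t : ℝ) : HasSum (fun n : ℕ ↦ ((n : ℝ) + 1) * besselCliffordCoeff ν (n + 1) * t ^ n)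
      (-besselClifford (ν + 1) t) := by
    simp_rw [succ_mul_besselCliffordCoeff_succ, neg_mul]
    exact (hasSum_besselClifford (ν + 1) t).neg
  rw [← (hderiv t).tsum_eq]
  exact hasDerivAt_tsum_mul_pow (fun t ↦ (hderiv t).summable) t

lemma continuous_besselClifford (ν : ℝ) : Continuous (besselClifford ν) :=
  continuous_iff_continuousAt.2 fun t ↦ (hasDerivAt_besselClifford ν t).continuousAt

lemma hasSum_natCast_mul_besselCliffordCoeff (ν t : ℝ) :
    HasSum (fun n : ℕ ↦ n * besselCliffordCoeff ν n * t ^ n) (-(t * besselClifford (ν + 1) t)) := by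
  refine (hasSum_nat_add_iff' 1).1 ?_
  rw [Finset.sum_range_one, Nat.cast_zero, zero_mul, zero_mul, sub_zero, ← mul_neg]
  refine ((hasSum_besselClifford (ν + 1) t).neg.mul_left t).congr_fun fun n ↦ ?_
  rw [Nat.cast_succ, succ_mul_besselCliffordCoeff_succ, pow_succ]
  ring

lemma besselClifford_eq_sub (ν t : ℝ) :
    besselClifford ν t =
      (ν + 1) * besselClifford (ν + 1) t - t * besselClifford (ν + 1 + 1) t := by
  refine (hasSum_besselClifford ν t).unique ?_
  rw [sub_eq_add_neg]
  refine (((hasSum_besselClifford (ν + 1) t).mul_left (ν + 1)).add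
    (hasSum_natCast_mul_besselCliffordCoeff (ν + 1) t)).congr_fun fun n ↦ ?_
  rw [besselCliffordCoeff_eq_mul]
  ring

lemma besselClifford_zero (ν : ℝ) : besselClifford ν 0 = (Real.Gamma (ν + 1))⁻¹ := by
  refine (tsum_eq_single 0 fun n hn ↦ by rw [zero_pow hn, mul_zero]).trans ?_
  simp [besselCliffordCoeff]

end BesselClifford

section Riccati

/-- The quotient `w = C_{ν+1} / C_ν` of consecutive Bessel–Clifford functions, which solves the
Riccati equation `t * w' = 1 - (ν + 1) * w + t * w ^ 2`. -/
noncomputable def besselCliffordRatio (ν t : ℝ) : ℝ :=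
  besselClifford (ν + 1) t / besselClifford ν t

/-- The Turán quotient `1 - C_{ν-1} * C_{ν+1} / C_ν ^ 2`, with `C_{ν-1}` eliminated by the
recurrence `besselClifford_eq_sub`. -/
noncomputable def besselCliffordTuran (ν t : ℝ) : ℝ :=
  1 - ν * besselCliffordRatio ν t + t * besselCliffordRatio ν t ^ 2

variable {ν T t : ℝ}

lemma hasDerivAt_besselClifford_of_ne_zero (h : besselClifford ν t ≠ 0) :
    HasDerivAt (besselClifford ν) (-(besselClifford ν t * besselCliffordRatio ν t)) t := by
  rw [besselCliffordRatio, mul_div_cancel₀ _ h]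
  exact hasDerivAt_besselClifford ν t

lemma continuousOn_besselCliffordRatio {s : Set ℝ} (h : ∀ t ∈ s, besselClifford ν t ≠ 0) :
    ContinuousOn (besselCliffordRatio ν) s :=
  (continuous_besselClifford (ν + 1)).continuousOn.div (continuous_besselClifford ν).continuousOn h

lemma continuousOn_besselCliffordTuran {s : Set ℝ} (h : ∀ t ∈ s, besselClifford ν t ≠ 0) :
    ContinuousOn (besselCliffordTuran ν) s := by
  have := continuousOn_besselCliffordRatio h
  unfold besselCliffordTuran
  fun_prop

lemma hasDerivAt_besselCliffordRatio (ht : t ≠ 0) (h : besselClifford ν t ≠ 0) :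
    HasDerivAt (besselCliffordRatio ν)
      ((besselCliffordTuran ν t - besselCliffordRatio ν t) / t) t := by
  refine ((hasDerivAt_besselClifford (ν + 1) t).div (hasDerivAt_besselClifford ν t) h).congr_deriv
    ?_
  have hrec : t * besselClifford (ν + 1 + 1) t =
      (ν + 1) * besselClifford (ν + 1) t - besselClifford ν t := by
    rw [besselClifford_eq_sub ν t]
    ring
  rw [besselCliffordTuran, besselCliffordRatio]
  field_simp
  linear_combination -besselClifford ν t * hrec

lemma hasDerivAt_mul_besselCliffordRatio (ht : t ≠ 0) (h : besselClifford ν t ≠ 0) :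
    HasDerivAt (fun t ↦ t * besselCliffordRatio ν t) (besselCliffordTuran ν t) t := by
  refine ((hasDerivAt_id' t).mul (hasDerivAt_besselCliffordRatio ht h)).congr_deriv ?_
  field_simp
  ring

lemma hasDerivAt_besselCliffordTuran (ht : t ≠ 0) (h : besselClifford ν t ≠ 0) :
    HasDerivAt (besselCliffordTuran ν)
      ((1 - (ν + 1 - 2 * (t * besselCliffordRatio ν t)) * besselCliffordTuran ν t) / t) t := by
  have hw := hasDerivAt_besselCliffordRatio ht h
  refine (((hw.const_mul ν).const_sub 1).add ((hasDerivAt_id' t).mul (hw.fun_pow 2))).congr_deriv ?_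
  rw [besselCliffordTuran]
  field_simp
  ring

lemma hasDerivAt_mul_besselCliffordTuran (ht : t ≠ 0) (h : besselClifford ν t ≠ 0) :
    HasDerivAt (fun t ↦ t * besselCliffordTuran ν t)
      (1 - (ν - 2 * (t * besselCliffordRatio ν t)) * besselCliffordTuran ν t) t := by
  refine ((hasDerivAt_id' t).mul (hasDerivAt_besselCliffordTuran ht h)).congr_deriv ?_
  field_simp
  ring

lemma hasDerivAt_one_sub_mul_besselCliffordTuran (ht : t ≠ 0) (h : besselClifford ν t ≠ 0) :
    HasDerivAt (fun t ↦ 1 - (ν - 2 * (t * besselCliffordRatio ν t)) * besselCliffordTuran ν t)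
      ((1 + 2 * t * besselCliffordTuran ν t ^ 2 - (ν + 1 - 2 * (t * besselCliffordRatio ν t)) *
        (1 - (ν - 2 * (t * besselCliffordRatio ν t)) * besselCliffordTuran ν t)) / t) t := by
  refine ((((hasDerivAt_mul_besselCliffordRatio ht h).const_mul 2).const_sub ν).mul
    (hasDerivAt_besselCliffordTuran ht h) |>.const_sub 1).congr_deriv ?_
  field_simp
  ring

lemma pos_of_besselCliffordRatio_mul_add_mul_deriv_pos {φ φ' : ℝ → ℝ} (hν : -1 < ν)
    (hC : ∀ t ∈ Ico 0 T, 0 < besselClifford ν t) (hc : ContinuousOn φ (Ico 0 T))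
    (hd : ∀ t ∈ Ioo 0 T, HasDerivAt φ (φ' t) t)
    (hpos : ∀ t ∈ Ioo 0 T, 0 < (ν + 1 - 2 * (t * besselCliffordRatio ν t)) * φ t + t * φ' t)
    (ht : t ∈ Ioo 0 T) : 0 < φ t := by
  have hC' {t : ℝ} (ht : t ∈ Ioo 0 T) := hC t (Ioo_subset_Ico_self ht)
  have h : 0 < besselClifford ν t ^ 2 * φ t :=
    pos_of_mul_add_mul_deriv_pos (show 0 < ν + 1 by linarith)
      (((continuous_besselClifford ν).continuousOn.pow 2).mul hc)
      (fun t ht ↦ ((hasDerivAt_besselClifford_of_ne_zero (hC' ht).ne').pow 2).mul (hd t ht))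
      (fun t ht ↦ (mul_pos (pow_pos (hC' ht) 2) (hpos t ht)).trans_eq (by simp; ring)) ht
  exact pos_of_mul_pos_right h (sq_nonneg _)

lemma besselCliffordTuran_pos (hν : -1 < ν) (hC : ∀ t ∈ Ico 0 T, 0 < besselClifford ν t)
    (ht : t ∈ Ioo 0 T) : 0 < besselCliffordTuran ν t := by
  have hne (t) (ht : t ∈ Ico 0 T) := (hC t ht).ne'
  refine pos_of_besselCliffordRatio_mul_add_mul_deriv_pos hν hC
    (continuousOn_besselCliffordTuran hne)
    (fun t ht ↦ hasDerivAt_besselCliffordTuran ht.1.ne' (hne t (Ioo_subset_Ico_self ht)))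
    (fun t ht ↦ ?_) ht
  rw [mul_div_cancel₀ _ ht.1.ne', add_sub_cancel]
  exact one_pos

lemma mul_besselCliffordTuran_lt_one (hν : -1 < ν)
    (hC : ∀ t ∈ Ico 0 T, 0 < besselClifford ν t) (ht : t ∈ Ioo 0 T) :
    (ν - 2 * (t * besselCliffordRatio ν t)) * besselCliffordTuran ν t < 1 := by
  have hne (t) (ht : t ∈ Ico 0 T) := (hC t ht).ne'
  have hw := continuousOn_besselCliffordRatio hne
  have hQ := continuousOn_besselCliffordTuran hne
  refine sub_pos.1 (pos_of_besselCliffordRatio_mul_add_mul_deriv_pos hν hC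
    (φ := fun t ↦ 1 - (ν - 2 * (t * besselCliffordRatio ν t)) * besselCliffordTuran ν t)
    (by fun_prop) (fun t ht ↦ hasDerivAt_one_sub_mul_besselCliffordTuran ht.1.ne'
      (hne t (Ioo_subset_Ico_self ht))) (fun t ht ↦ ?_) ht)
  rw [mul_div_cancel₀ _ ht.1.ne', add_sub_cancel]
  exact add_pos_of_pos_of_nonneg one_pos (mul_nonneg (by linarith [ht.1]) (sq_nonneg _))

lemma monotoneOn_mul_besselCliffordRatio (hν : -1 < ν)
    (hC : ∀ t ∈ Ico 0 T, 0 < besselClifford ν t) :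
    MonotoneOn (fun t ↦ t * besselCliffordRatio ν t) (Ico 0 T) := by
  refine monotoneOn_of_hasDerivWithinAt_nonneg (convex_Ico 0 T)
    (continuousOn_id.mul (continuousOn_besselCliffordRatio fun t ht ↦ (hC t ht).ne'))
    (f' := besselCliffordTuran ν) ?_ ?_ <;> rw [interior_Ico] <;> intro t ht
  · exact (hasDerivAt_mul_besselCliffordRatio ht.1.ne'
      (hC t (Ioo_subset_Ico_self ht)).ne').hasDerivWithinAt
  · exact (besselCliffordTuran_pos hν hC ht).le

lemma monotoneOn_mul_besselCliffordTuran (hν : -1 < ν)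
    (hC : ∀ t ∈ Ico 0 T, 0 < besselClifford ν t) :
    MonotoneOn (fun t ↦ t * besselCliffordTuran ν t) (Ioo 0 T) := by
  have hderiv (t) (ht : t ∈ Ioo 0 T) := hasDerivAt_mul_besselCliffordTuran ht.1.ne'
    (hC t (Ioo_subset_Ico_self ht)).ne'
  refine monotoneOn_of_hasDerivWithinAt_nonneg (convex_Ioo 0 T)
    (fun t ht ↦ (hderiv t ht).continuousAt.continuousWithinAt) ?_ ?_
    (f' := fun t ↦ 1 - (ν - 2 * (t * besselCliffordRatio ν t)) * besselCliffordTuran ν t) <;>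
    rw [interior_Ioo] <;> intro t ht
  · exact (hderiv t ht).hasDerivWithinAt
  · exact sub_nonneg.2 (mul_besselCliffordTuran_lt_one hν hC ht).le

lemma besselCliffordRatio_nonneg (hν : -1 < ν) (hC : ∀ t ∈ Ico 0 T, 0 < besselClifford ν t)
    (ht : t ∈ Ioo 0 T) : 0 ≤ besselCliffordRatio ν t := by
  have hle : 0 * besselCliffordRatio ν 0 ≤ t * besselCliffordRatio ν t :=
    monotoneOn_mul_besselCliffordRatio hν hC (left_mem_Ico.2 (ht.1.trans ht.2))
      (Ioo_subset_Ico_self ht) ht.1.le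
  rw [zero_mul] at hle
  exact nonneg_of_mul_nonneg_right hle ht.1

lemma half_le_besselCliffordTuran (ht : 0 < t) (hνt : ν ^ 2 ≤ 2 * t) :
    1 / 2 ≤ besselCliffordTuran ν t := by
  refine le_of_mul_le_mul_left ?_ ht
  rw [besselCliffordTuran]
  linarith [sq_nonneg (t * besselCliffordRatio ν t - ν / 2)]

end Riccati

section NormalizedDini

/-- The Dini function normalized to be entire with value `1` at `0`: for `x > 0`,
`d_ν(x) = (x / 2) ^ ν / Γ(ν + 1) * normalizedDini ν (x ^ 2 / 4)`. -/
noncomputable def normalizedDini (ν t : ℝ) : ℝ :=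
  Real.Gamma (ν + 1) * (besselClifford ν t - 2 * (t * besselClifford (ν + 1) t))

variable {ν μ T t : ℝ}

lemma hasSum_normalizedDini (ν t : ℝ) :
    HasSum (fun n : ℕ ↦ Real.Gamma (ν + 1) * ((2 * n + 1) * besselCliffordCoeff ν n) * t ^ n)
      (normalizedDini ν t) := by
  rw [normalizedDini, sub_eq_add_neg, ← mul_neg]
  refine (((hasSum_besselClifford ν t).add ((hasSum_natCast_mul_besselCliffordCoeff ν t).mul_left
    2)).mul_left (Real.Gamma (ν + 1))).congr_fun fun n ↦ ?_
  ring

lemma differentiable_normalizedDini (ν : ℝ) : Differentiable ℝ (normalizedDini ν) := by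
  have hC (ν : ℝ) : Differentiable ℝ (besselClifford ν) :=
    fun t ↦ (hasDerivAt_besselClifford ν t).differentiableAt
  have := hC ν
  have := hC (ν + 1)
  unfold normalizedDini
  fun_prop

lemma normalizedDini_zero (hν : -1 < ν) : normalizedDini ν 0 = 1 := by
  rw [normalizedDini, besselClifford_zero, zero_mul, mul_zero, sub_zero,
    mul_inv_cancel₀ (Real.Gamma_pos_of_pos (by linarith)).ne']

lemma normalizedDini_eq_mul (h : besselClifford ν t ≠ 0) :
    normalizedDini ν t =
      Real.Gamma (ν + 1) * besselClifford ν t * (1 - 2 * (t * besselCliffordRatio ν t)) := by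
  rw [normalizedDini, besselCliffordRatio]
  field_simp

lemma hasDerivAt_normalizedDini (h : besselClifford ν t ≠ 0) :
    HasDerivAt (normalizedDini ν)
      (-(Real.Gamma (ν + 1) * besselClifford ν t * (besselCliffordRatio ν t *
        (1 - 2 * (t * besselCliffordRatio ν t)) + 2 * besselCliffordTuran ν t))) t := by
  refine (((hasDerivAt_besselClifford ν t).sub (((hasDerivAt_id' t).mul
    (hasDerivAt_besselClifford (ν + 1) t)).const_mul 2)).const_mul _).congr_deriv ?_
  have hrec := besselClifford_eq_sub ν t
  have hratio : besselClifford ν t * besselCliffordRatio ν t = besselClifford (ν + 1) t :=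
    mul_div_cancel₀ _ h
  rw [besselCliffordTuran]
  linear_combination Real.Gamma (ν + 1) * ((1 - 2 * ν) * hratio + 2 * hrec)

lemma mul_logDeriv_normalizedDini (hν : -1 < ν) (hC : besselClifford ν t ≠ 0)
    (hw : 1 - 2 * (t * besselCliffordRatio ν t) ≠ 0) :
    t * logDeriv (normalizedDini ν) t = -(t * besselCliffordRatio ν t +
      2 * (t * besselCliffordTuran ν t) / (1 - 2 * (t * besselCliffordRatio ν t))) := by
  have hΓ : Real.Gamma (ν + 1) ≠ 0 := (Real.Gamma_pos_of_pos (by linarith)).ne'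
  rw [logDeriv_apply, (hasDerivAt_normalizedDini hC).deriv, normalizedDini_eq_mul hC, neg_div,
    mul_div_mul_left _ _ (mul_ne_zero hΓ hC), add_div, mul_div_cancel_right₀ _ hw]
  ring

lemma besselClifford_pos_of_normalizedDini_pos (hν : -1 < ν)
    (hN : ∀ t ∈ Ico 0 T, 0 < normalizedDini ν t) (ht : t ∈ Ico 0 T) :
    0 < besselClifford ν t := by
  have hΓ : 0 < Real.Gamma (ν + 1) := Real.Gamma_pos_of_pos (by linarith)
  rcases ht.1.eq_or_lt with rfl | ht0
  · rw [besselClifford_zero]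
    exact inv_pos.2 hΓ
  refine pos_of_mul_add_mul_deriv_pos one_half_pos (continuous_besselClifford ν).continuousOn
    (fun t _ ↦ hasDerivAt_besselClifford ν t) (fun t ht ↦ ?_) ⟨ht0, ht.2⟩
  have hd : 0 < besselClifford ν t - 2 * (t * besselClifford (ν + 1) t) :=
    pos_of_mul_pos_right (hN t (Ioo_subset_Ico_self ht)) hΓ.le
  linarith

lemma one_sub_two_mul_mul_besselCliffordRatio_pos (hν : -1 < ν)
    (hN : ∀ t ∈ Ico 0 T, 0 < normalizedDini ν t) (ht : t ∈ Ico 0 T) :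
    0 < 1 - 2 * (t * besselCliffordRatio ν t) := by
  have hC := besselClifford_pos_of_normalizedDini_pos hν hN ht
  refine pos_of_mul_pos_right ((hN t ht).trans_eq (normalizedDini_eq_mul hC.ne')) ?_
  exact mul_nonneg (Real.Gamma_pos_of_pos (by linarith)).le hC.le

lemma antitoneOn_normalizedDini (hν : -1 < ν)
    (hN : ∀ t ∈ Ico 0 T, 0 < normalizedDini ν t) :
    AntitoneOn (normalizedDini ν) (Ico 0 T) := by
  refine antitoneOn_of_deriv_nonpos (convex_Ico 0 T)
    (differentiable_normalizedDini ν).continuous.continuousOn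
    (differentiable_normalizedDini ν).differentiableOn fun t ht ↦ ?_
  rw [interior_Ico] at ht
  have hC {t : ℝ} (ht : t ∈ Ico 0 T) := besselClifford_pos_of_normalizedDini_pos hν hN ht
  have hCt := hC (Ioo_subset_Ico_self ht)
  have hw := one_sub_two_mul_mul_besselCliffordRatio_pos hν hN (Ioo_subset_Ico_self ht)
  have hw0 := besselCliffordRatio_nonneg hν (fun _ ↦ hC) ht
  have hQ := besselCliffordTuran_pos hν (fun _ ↦ hC) ht
  have hΓ : 0 < Real.Gamma (ν + 1) := Real.Gamma_pos_of_pos (by linarith)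
  rw [(hasDerivAt_normalizedDini hCt.ne').deriv]
  exact neg_nonpos.2 (by positivity)

lemma antitoneOn_mul_logDeriv_normalizedDini (hν : -1 < ν)
    (hN : ∀ t ∈ Ico 0 T, 0 < normalizedDini ν t) :
    AntitoneOn (fun t ↦ t * logDeriv (normalizedDini ν) t) (Ioo 0 T) := by
  intro s hs t ht hst
  have hC {t : ℝ} (ht : t ∈ Ico 0 T) := besselClifford_pos_of_normalizedDini_pos hν hN ht
  have hs' := Ioo_subset_Ico_self hs
  have ht' := Ioo_subset_Ico_self ht
  have hwt := one_sub_two_mul_mul_besselCliffordRatio_pos hν hN ht'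
  have hP : s * besselCliffordRatio ν s ≤ t * besselCliffordRatio ν t :=
    monotoneOn_mul_besselCliffordRatio hν (fun _ ↦ hC) hs' ht' hst
  have hQ : s * besselCliffordTuran ν s ≤ t * besselCliffordTuran ν t :=
    monotoneOn_mul_besselCliffordTuran hν (fun _ ↦ hC) hs ht hst
  have hQt : 0 ≤ t * besselCliffordTuran ν t :=
    mul_nonneg ht.1.le (besselCliffordTuran_pos hν (fun _ ↦ hC) ht).le
  simp only [mul_logDeriv_normalizedDini hν (hC hs').ne'
    (one_sub_two_mul_mul_besselCliffordRatio_pos hν hN hs').ne',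
    mul_logDeriv_normalizedDini hν (hC ht').ne' hwt.ne']
  gcongr

lemma exists_normalizedDini_eq_zero (hν : -1 < ν) : ∃ t, 0 < t ∧ normalizedDini ν t = 0 := by
  by_contra! hne
  have hN {T : ℝ} (t) (ht : t ∈ Ico 0 T) : 0 < normalizedDini ν t :=
    pos_of_forall_ne_zero (differentiable_normalizedDini ν).continuous
      (one_pos.trans_eq (normalizedDini_zero hν).symm) ht.1 fun s hs ↦ hne s hs.1
  have hC {T : ℝ} (t) (ht : t ∈ Ico 0 T) := besselClifford_pos_of_normalizedDini_pos hν hN ht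
  let a : ℝ := ν ^ 2 / 2 + 1
  have ha : 0 < a := by positivity
  have hderiv (t) (ht : t ∈ Icc a (a + 1)) :
      HasDerivAt (fun t ↦ t * besselCliffordRatio ν t) (besselCliffordTuran ν t) t :=
    hasDerivAt_mul_besselCliffordRatio (ha.trans_le ht.1).ne'
      (hC t ⟨ha.le.trans ht.1, lt_add_one t⟩).ne'
  have hgrow : 1 / 2 * (a + 1 - a) ≤
      (a + 1) * besselCliffordRatio ν (a + 1) - a * besselCliffordRatio ν a := by
    refine (convex_Icc a (a + 1)).mul_sub_le_image_sub_of_le_deriv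
      (f := fun t ↦ t * besselCliffordRatio ν t)
      (fun t ht ↦ (hderiv t ht).continuousAt.continuousWithinAt)
      (fun t ht ↦ (hderiv t (interior_subset ht)).differentiableAt.differentiableWithinAt)
      (fun t ht ↦ ?_) a (left_mem_Icc.2 (by simp)) (a + 1) (right_mem_Icc.2 (by simp)) (by simp)
    have ht' : ν ^ 2 / 2 + 1 ≤ t := (interior_subset ht).1
    rw [(hderiv t (interior_subset ht)).deriv]
    exact half_le_besselCliffordTuran (ha.trans_le ht') (by linarith)
  have hlt := one_sub_two_mul_mul_besselCliffordRatio_pos hν hN (t := a + 1)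
    ⟨by positivity, lt_add_one _⟩
  have hnonneg := mul_nonneg ha.le (besselCliffordRatio_nonneg hν hC ⟨ha, lt_add_one a⟩)
  linarith

lemma Gamma_mul_besselCliffordCoeff_eq_mul_integral (hν : -1 < ν) (hμ : ν < μ) (n : ℕ) :
    Real.Gamma (μ + 1) * besselCliffordCoeff μ n = Real.Gamma (ν + 1) * besselCliffordCoeff ν n *
      ∫ u, u ^ n ∂betaMeasure (ν + 1) (μ - ν) := by
  have hν' : 0 < ν + 1 := by linarith
  have hνn : 0 < ν + 1 + n := by positivity
  have hmoment := integral_rpow_betaMeasure hν' (sub_pos.2 hμ) hνn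
  simp_rw [Real.rpow_natCast] at hmoment
  rw [hmoment]
  simp only [besselCliffordCoeff, beta]
  rw [show ν + 1 + n + (μ - ν) = n + μ + 1 by ring, show ν + 1 + (μ - ν) = μ + 1 by ring,
    show ν + 1 + n = n + ν + 1 by ring]
  have hΓμ := Real.Gamma_pos_of_pos (show 0 < μ + 1 by linarith)
  have hΓνn := Real.Gamma_pos_of_pos (show 0 < n + ν + 1 by linarith)
  have hΓμn := Real.Gamma_pos_of_pos (show 0 < n + μ + 1 by linarith)
  have hΓμν := Real.Gamma_pos_of_pos (sub_pos.2 hμ)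
  field_simp

lemma normalizedDini_eq_integral (hν : -1 < ν) (hμ : ν < μ) (t : ℝ) :
    normalizedDini μ t = ∫ u, normalizedDini ν (t * u) ∂betaMeasure (ν + 1) (μ - ν) := by
  have := isProbabilityMeasureBeta (show 0 < ν + 1 by linarith) (sub_pos.2 hμ)
  refine (hasSum_normalizedDini μ t).unique ((hasSum_integral_comp_mul
    (ae_betaMeasure_abs_le_one _ _) (hasSum_normalizedDini ν) t).congr_fun fun n ↦ ?_)
  rw [mul_left_comm, Gamma_mul_besselCliffordCoeff_eq_mul_integral hν hμ]
  ring

lemma normalizedDini_le_normalizedDini (hν : -1 < ν)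
    (hN : ∀ t ∈ Ico 0 T, 0 < normalizedDini ν t) (hμ : ν ≤ μ) (ht : t ∈ Ico 0 T) :
    normalizedDini ν t ≤ normalizedDini μ t := by
  rcases hμ.eq_or_lt with rfl | hμ
  · rfl
  have := isProbabilityMeasureBeta (show 0 < ν + 1 by linarith) (sub_pos.2 hμ)
  calc normalizedDini ν t = ∫ _, normalizedDini ν t ∂betaMeasure (ν + 1) (μ - ν) := by simp
    _ ≤ ∫ u, normalizedDini ν (t * u) ∂betaMeasure (ν + 1) (μ - ν) := by
      refine integral_mono_ae (integrable_const _) (integrable_comp_mul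
        (ae_betaMeasure_abs_le_one _ _) (differentiable_normalizedDini ν).continuous t) ?_
      filter_upwards [ae_betaMeasure_mem_Ioo (ν + 1) (μ - ν)] with u hu
      have hle : t * u ≤ t := mul_le_of_le_one_right ht.1 hu.2.le
      exact antitoneOn_normalizedDini hν hN ⟨mul_nonneg ht.1 hu.1.le, hle.trans_lt ht.2⟩ ht hle
    _ = normalizedDini μ t := (normalizedDini_eq_integral hν hμ t).symm

lemma monotoneOn_normalizedDini_div (hν : -1 < ν)
    (hN : ∀ t ∈ Ico 0 T, 0 < normalizedDini ν t) (hμ : ν ≤ μ) :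
    MonotoneOn (fun t ↦ normalizedDini μ t / normalizedDini ν t) (Ioo 0 T) := by
  have hN' (t) (ht : t ∈ Ioo 0 T) := hN t (Ioo_subset_Ico_self ht)
  intro s hs t ht hst
  rcases hμ.eq_or_lt with rfl | hμ
  · simp only [div_self (hN' s hs).ne', div_self (hN' t ht).ne', le_refl]
  have := isProbabilityMeasureBeta (show 0 < ν + 1 by linarith) (sub_pos.2 hμ)
  have hint (t : ℝ) : Integrable (fun u ↦ normalizedDini ν (t * u) / normalizedDini ν t)
      (betaMeasure (ν + 1) (μ - ν)) :=
    (integrable_comp_mul (ae_betaMeasure_abs_le_one _ _)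
      (differentiable_normalizedDini ν).continuous t).div_const _
  simp only [normalizedDini_eq_integral hν hμ, ← integral_div]
  refine integral_mono_ae (hint s) (hint t) ?_
  filter_upwards [ae_betaMeasure_mem_Ioo (ν + 1) (μ - ν)] with u hu
  exact monotoneOn_comp_mul_div (fun t _ ↦ differentiable_normalizedDini ν t) hN'
    (antitoneOn_mul_logDeriv_normalizedDini hν hN) hu hs ht hst

end NormalizedDini

section Dini

variable {ν μ x t : ℝ}

lemma besselJ_eq_mul_besselClifford (ν : ℝ) (hx : 0 < x) :
    besselJ ν x = (x / 2) ^ ν * besselClifford ν (x ^ 2 / 4) := by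
  rw [besselJ, besselClifford, ← tsum_mul_left]
  refine tsum_congr fun n ↦ ?_
  have hpow : (x / 2) ^ (2 * (n : ℝ) + ν) = (x / 2) ^ ν * (x ^ 2 / 4) ^ n := by
    rw [add_comm, Real.rpow_add (by positivity), Real.rpow_mul (by positivity),
      Real.rpow_natCast, Real.rpow_two, div_pow]
    norm_num
  rw [hpow, besselCliffordCoeff]
  ring

lemma hasDerivAt_besselJ (ν : ℝ) (hx : 0 < x) :
    HasDerivAt (besselJ ν) (ν / x * besselJ ν x - besselJ (ν + 1) x) x := by
  have hsq : HasDerivAt (fun x : ℝ ↦ x ^ 2 / 4) (x / 2) x :=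
    ((hasDerivAt_pow 2 x).div_const 4).congr_deriv (by push_cast; ring)
  have hpow : HasDerivAt (fun x : ℝ ↦ (x / 2) ^ ν) (ν / x * (x / 2) ^ ν) x := by
    refine (((hasDerivAt_id' x).div_const 2).rpow_const (Or.inl (by positivity))).congr_deriv ?_
    rw [Real.rpow_sub_one (by positivity)]
    field_simp
  refine (hpow.mul ((hasDerivAt_besselClifford ν (x ^ 2 / 4)).comp x hsq)).congr_deriv ?_
    |>.congr_of_eventuallyEq ?_
  · rw [besselJ_eq_mul_besselClifford ν hx, besselJ_eq_mul_besselClifford (ν + 1) hx,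
      Real.rpow_add_one (by positivity), Function.comp_apply]
    ring
  · filter_upwards [Ioi_mem_nhds hx] with y hy using besselJ_eq_mul_besselClifford ν hy

lemma dini_eq_besselJ_sub (ν : ℝ) (hx : 0 < x) :
    dini ν x = besselJ ν x - x * besselJ (ν + 1) x := by
  rw [dini, (hasDerivAt_besselJ ν hx).deriv]
  field_simp
  ring

lemma differentiableAt_dini (ν : ℝ) (hx : 0 < x) : DifferentiableAt ℝ (dini ν) x := by
  have h := (hasDerivAt_besselJ ν hx).differentiableAt.sub
    (differentiableAt_id.mul (hasDerivAt_besselJ (ν + 1) hx).differentiableAt)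
  refine h.congr_of_eventuallyEq ?_
  filter_upwards [Ioi_mem_nhds hx] with y hy using dini_eq_besselJ_sub ν hy

lemma normalizedDini_eq_mul_dini (hx : 0 < x) :
    normalizedDini ν (x ^ 2 / 4) = 2 ^ ν * Real.Gamma (ν + 1) * x ^ (-ν) * dini ν x := by
  rw [dini_eq_besselJ_sub ν hx, besselJ_eq_mul_besselClifford ν hx,
    besselJ_eq_mul_besselClifford (ν + 1) hx, normalizedDini, Real.rpow_add_one (by positivity),
    Real.div_rpow hx.le zero_le_two, Real.rpow_neg hx.le]
  field_simp
  ring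

lemma dini_eq_mul_normalizedDini (hν : -1 < ν) (hx : 0 < x) :
    dini ν x = (x / 2) ^ ν / Real.Gamma (ν + 1) * normalizedDini ν (x ^ 2 / 4) := by
  have hΓ := Real.Gamma_pos_of_pos (show 0 < ν + 1 by linarith)
  rw [normalizedDini_eq_mul_dini hx, Real.div_rpow hx.le zero_le_two, Real.rpow_neg hx.le]
  field_simp

lemma dini_eq_zero_iff (hν : -1 < ν) (hx : 0 < x) :
    dini ν x = 0 ↔ normalizedDini ν (x ^ 2 / 4) = 0 := by
  have hΓ := Real.Gamma_pos_of_pos (show 0 < ν + 1 by linarith)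
  rw [dini_eq_mul_normalizedDini hν hx, mul_eq_zero, or_iff_right (by positivity)]

lemma two_mul_sqrt_sq_div_four (ht : 0 ≤ t) : (2 * √t) ^ 2 / 4 = t := by
  rw [mul_pow, Real.sq_sqrt ht]
  ring

lemma isLeast_diniZero (hν : -1 < ν) : IsLeast {x | 0 < x ∧ dini ν x = 0} (diniZero ν) := by
  have hzeros : {x | 0 < x ∧ dini ν x = 0} = {x | 0 < x ∧ normalizedDini ν (x ^ 2 / 4) = 0} :=
    Set.ext fun x ↦ and_congr_right fun hx ↦ dini_eq_zero_iff hν hx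
  obtain ⟨t, ht, hzero⟩ := exists_normalizedDini_eq_zero hν
  rw [diniZero, hzeros]
  refine isLeast_sInf_pos_zeros
    ((differentiable_normalizedDini ν).continuous.comp (by fun_prop)) ?_ ⟨2 * √t, by positivity, ?_⟩
  · norm_num [normalizedDini_zero hν]
  · rwa [two_mul_sqrt_sq_div_four ht.le]

lemma normalizedDini_pos (hν : -1 < ν) (ht : t ∈ Ico 0 (diniZero ν ^ 2 / 4)) :
    0 < normalizedDini ν t := by
  refine pos_of_forall_ne_zero (differentiable_normalizedDini ν).continuous
    (one_pos.trans_eq (normalizedDini_zero hν).symm) ht.1 fun s hs hzero ↦ ?_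
  have hs' : 0 < 2 * √s := mul_pos two_pos (Real.sqrt_pos.2 hs.1)
  have hle : diniZero ν ≤ 2 * √s := by
    refine (isLeast_diniZero hν).2 ⟨hs', (dini_eq_zero_iff hν hs').2 ?_⟩
    rwa [two_mul_sqrt_sq_div_four hs.1.le]
  have hsq : diniZero ν ^ 2 / 4 ≤ (2 * √s) ^ 2 / 4 := by
    have := (isLeast_diniZero hν).1.1
    gcongr
  rw [two_mul_sqrt_sq_div_four hs.1.le] at hsq
  linarith [hs.2, ht.2]

lemma sq_div_four_mem_Ioo {α : ℝ} (hx : x ∈ Ioo 0 α) : x ^ 2 / 4 ∈ Ioo 0 (α ^ 2 / 4) := by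
  obtain ⟨hx0, hxα⟩ := hx
  exact ⟨by positivity, by gcongr⟩

lemma normalizedDini_sq_div_four_le (hν : -1 < ν) (hμ : ν ≤ μ) (hx : x ∈ Ioo 0 (diniZero ν)) :
    normalizedDini ν (x ^ 2 / 4) ≤ normalizedDini μ (x ^ 2 / 4) :=
  normalizedDini_le_normalizedDini hν (fun _ ↦ normalizedDini_pos hν) hμ
    (Ioo_subset_Ico_self (sq_div_four_mem_Ioo hx))

lemma normalizedDini_sq_div_four_pos (hν : -1 < ν) (hx : x ∈ Ioo 0 (diniZero ν)) :
    0 < normalizedDini ν (x ^ 2 / 4) :=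
  normalizedDini_pos hν (Ioo_subset_Ico_self (sq_div_four_mem_Ioo hx))

lemma dini_pos (hν : -1 < ν) (hμ : ν ≤ μ) (hx : x ∈ Ioo 0 (diniZero ν)) : 0 < dini μ x := by
  have hN := (normalizedDini_sq_div_four_pos hν hx).trans_le
    (normalizedDini_sq_div_four_le hν hμ hx)
  have hΓ := Real.Gamma_pos_of_pos (show 0 < μ + 1 by linarith)
  have hxμ := Real.rpow_pos_of_pos (half_pos hx.1) μ
  rw [dini_eq_mul_normalizedDini (hν.trans_le hμ) hx.1]
  positivity

lemma diniZero_le_diniZero (hν : -1 < ν) (hμ : ν ≤ μ) : diniZero ν ≤ diniZero μ := by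
  by_contra! hlt
  obtain ⟨hpos, hzero⟩ := (isLeast_diniZero (hν.trans_le hμ)).1
  exact (dini_pos hν hμ ⟨hpos, hlt⟩).ne' hzero

lemma monotoneOn_rpow_mul_dini (hν : -1 < ν) (hx : x ∈ Ioo 0 (diniZero ν)) :
    MonotoneOn (fun μ : ℝ ↦ (2 : ℝ) ^ μ * Real.Gamma (μ + 1) * x ^ (-μ) * dini μ x) (Ici ν) := by
  intro κ hκ μ _ hκμ
  simp only [← normalizedDini_eq_mul_dini hx.1]
  exact normalizedDini_sq_div_four_le (hν.trans_le hκ) hκμ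
    ⟨hx.1, hx.2.trans_le (diniZero_le_diniZero hν hκ)⟩

lemma dini_div_dini (hν : -1 < ν) (hμ : -1 < μ) (hx : 0 < x) :
    dini μ x / dini ν x = 2 ^ (ν - μ) * (Real.Gamma (ν + 1) / Real.Gamma (μ + 1)) *
      x ^ (μ - ν) * (normalizedDini μ (x ^ 2 / 4) / normalizedDini ν (x ^ 2 / 4)) := by
  rw [dini_eq_mul_normalizedDini hν hx, dini_eq_mul_normalizedDini hμ hx,
    Real.rpow_sub hx, Real.rpow_sub two_pos, Real.div_rpow hx.le zero_le_two,
    Real.div_rpow hx.le zero_le_two, mul_div_mul_comm]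
  congr 1
  field_simp

lemma le_rpow_mul_dini_div_dini (hν : -1 < ν) (hμ : ν ≤ μ) (hx : x ∈ Ioo 0 (diniZero ν)) :
    (2 : ℝ) ^ (ν - μ) * (Real.Gamma (ν + 1) / Real.Gamma (μ + 1)) ≤
      x ^ (ν - μ) * (dini μ x / dini ν x) := by
  have hΓν := Real.Gamma_pos_of_pos (show 0 < ν + 1 by linarith)
  have hΓμ := Real.Gamma_pos_of_pos (show 0 < μ + 1 by linarith)
  have hx0 := (Real.rpow_pos_of_pos hx.1 (ν - μ)).ne'
  have hratio : 1 ≤ normalizedDini μ (x ^ 2 / 4) / normalizedDini ν (x ^ 2 / 4) :=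
    (one_le_div (normalizedDini_sq_div_four_pos hν hx)).2 (normalizedDini_sq_div_four_le hν hμ hx)
  rw [dini_div_dini hν (hν.trans_le hμ) hx.1, ← neg_sub ν μ, Real.rpow_neg hx.1.le, mul_right_comm,
    mul_left_comm, mul_inv_cancel₀ hx0, mul_one]
  exact le_mul_of_one_le_right (by positivity) hratio

lemma monotoneOn_dini_div_dini (hν : -1 < ν) (hμ : ν ≤ μ) :
    MonotoneOn (fun x ↦ dini μ x / dini ν x) (Ioo 0 (diniZero ν)) := by
  intro x hx y hy hxy
  have hΓν := Real.Gamma_pos_of_pos (show 0 < ν + 1 by linarith)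
  have hΓμ := Real.Gamma_pos_of_pos (show 0 < μ + 1 by linarith)
  have hx0 := hx.1
  have hy0 := hy.1
  have hratio : normalizedDini μ (x ^ 2 / 4) / normalizedDini ν (x ^ 2 / 4) ≤
      normalizedDini μ (y ^ 2 / 4) / normalizedDini ν (y ^ 2 / 4) :=
    monotoneOn_normalizedDini_div hν (fun _ ↦ normalizedDini_pos hν) hμ (sq_div_four_mem_Ioo hx)
      (sq_div_four_mem_Ioo hy) (by gcongr)
  have hpos : 0 ≤ normalizedDini μ (x ^ 2 / 4) / normalizedDini ν (x ^ 2 / 4) :=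
    have hN := normalizedDini_sq_div_four_pos hν hx
    div_nonneg (hN.le.trans (normalizedDini_sq_div_four_le hν hμ hx)) hN.le
  have hpow : x ^ (μ - ν) ≤ y ^ (μ - ν) := Real.rpow_le_rpow hx0.le hxy (sub_nonneg.2 hμ)
  simp only [dini_div_dini hν (hν.trans_le hμ) hx0, dini_div_dini hν (hν.trans_le hμ) hy0]
  gcongr

lemma deriv_dini_div_dini_le (hν : -1 < ν) (hμ : ν ≤ μ) (hx : x ∈ Ioo 0 (diniZero ν)) :
    deriv (dini ν) x / dini ν x ≤ deriv (dini μ) x / dini μ x :=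
  (monotoneOn_div_iff_logDeriv_le isOpen_Ioo (convex_Ioo 0 (diniZero ν))
    (fun _ hx ↦ differentiableAt_dini μ hx.1) (fun _ hx ↦ differentiableAt_dini ν hx.1)
    (fun _ ↦ dini_pos hν hμ) (fun _ ↦ dini_pos hν le_rfl)).1 (monotoneOn_dini_div_dini hν hμ) x hx

lemma monotoneOn_mul_deriv_dini_div_dini (hν : -1 < ν) (hx : x ∈ Ioo 0 (diniZero ν)) :
    MonotoneOn (fun μ ↦ x * deriv (dini μ) x / dini μ x) (Ici ν) := by
  intro κ hκ μ _ hκμ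
  have hxκ : x ∈ Ioo 0 (diniZero κ) := ⟨hx.1, hx.2.trans_le (diniZero_le_diniZero hν hκ)⟩
  simp only [mul_div_assoc]
  exact mul_le_mul_of_nonneg_left (deriv_dini_div_dini_le (hν.trans_le hκ) hκμ hxκ) hx.1.le

end Dini

theorem theorem6 (ν : ℝ) (hν : -1 < ν) :
    IsLeast {x : ℝ | 0 < x ∧ dini ν x = 0} (diniZero ν) ∧
    (∀ x ∈ Set.Ioo 0 (diniZero ν),
      (∀ μ : ℝ, ν ≤ μ → 0 < dini μ x) ∧
      MonotoneOn (fun μ : ℝ => (2 : ℝ) ^ μ * Real.Gamma (μ + 1) * x ^ (-μ) * dini μ x)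
        (Set.Ici ν) ∧
      MonotoneOn (fun μ : ℝ => x * deriv (dini μ) x / dini μ x) (Set.Ici ν) ∧
      (∀ μ : ℝ, ν ≤ μ →
        (2 : ℝ) ^ (ν - μ) * (Real.Gamma (ν + 1) / Real.Gamma (μ + 1)) ≤
            x ^ (ν - μ) * (dini μ x / dini ν x) ∧
          deriv (dini ν) x / dini ν x ≤ deriv (dini μ) x / dini μ x)) ∧
    (∀ μ : ℝ, ν ≤ μ →
      MonotoneOn (fun x : ℝ => dini μ x / dini ν x) (Set.Ioo 0 (diniZero ν))) :=
  ⟨isLeast_diniZero hν,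
    fun _ hx ↦ ⟨fun _ hμ ↦ dini_pos hν hμ hx,
      monotoneOn_rpow_mul_dini hν hx,
      monotoneOn_mul_deriv_dini_div_dini hν hx,
      fun _ hμ ↦ ⟨le_rpow_mul_dini_div_dini hν hμ hx, deriv_dini_div_dini_le hν hμ hx⟩⟩,
    fun _ hμ ↦ monotoneOn_dini_div_dini hν hμ⟩
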